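/- Let $\mathbb k$ be an algebraically closed field of characteristic zero and let $G$ be a finite group. Let $\mathbb k^{G\,\mathrm{cop}}$ be the algebra of functions $G\to\mathbb k$, with basis $\{e_g\}_{g\in G}$ dual to $G$ and comultiplication $\Delta(e_g)=\sum_{ab=g}e_b\otimes e_a$. The Drinfeld double $D(G)$ is the Hopf algebra with basis $\{e_g\# h\}_{g,h\in G}$ which as a coalgebra is $\mathbb k^{G\,\mathrm{cop}}\otimes\mathbb kG$ and which has multiplication $(e_g\# g')(e_h\# h')=\delta_{g,\,g'hg'^{-1}}\,e_g\# g'h'$ and unit $\varepsilon\# 1$, where $\varepsilon=\sum_g e_g$. A Hopf algebra automorphism $\psi$ of $D(G)$ is written $\psi=(p,u,r,v)$, where $$u(a)=(\mathrm{id}\otimes\varepsilon_{\mathbb kG})\psi(a\#1),\quad p(a)=(\mathrm{ev}_1\otimes\mathrm{id})\psi(a\#1),\quad r(g)=(\mathrm{id}\otimes\varepsilon_{\mathbb kG})\psi(\varepsilon\#g),\quad v(g)=(\mathrm{ev}_1\otimes\mathrm{id})\psi(\varepsilon\#g);$$ here $\varepsilon_{\mathbb kG}$ is the counit of $\mathbb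 kG$ and $\mathrm{ev}_1$ is evaluation of functions at $1\in G$. Let $u^*\colon\mathbb kG\to\mathbb kG$ be the linear dual of $u\colon\mathbb k^{G\,\mathrm{cop}}\to\mathbb k^{G\,\mathrm{cop}}$. An abelian direct factor of $G$ is an abelian subgroup $K$ such that $G$ is the internal direct product of $K$ and some subgroup $N$; $G$ is purely non-abelian if its only abelian direct factor is the trivial subgroup. **Theorem.** Let $\psi=(p,u,r,v)$ be a Hopf algebra automorphism of $D(G)$. Then $u^*$ and $v$ restrict to group endomorphisms of $G$, the group $\ker(u^*)$ is contained in an abelian direct factor of $G$, and the group $\ker(v)$ is contained in an abelian direct factor of $G$ (not necessarily the same one). In particular, if $G$ is purely non-abelian, then for every Hopf algebra automorphism $\psi=(p,u,r,v)$ of $D(G)$ the maps $u\colon\mathbb k^{G\,\mathrm{cop}}\to\mathbb k^{G\,\mathrm{cop}}$ and $v\colon\mathbb kG\to\mathbb kG$ are isomorphisms of Hopf algebras. -/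

import Mathlib

open scoped TensorProduct

set_option linter.unusedSectionVars false

noncomputable section

/-! ### Abelian direct factors -/

/-- `K` is an abelian direct factor of `G`: `K` is abelian and `G` is the internal direct product
of `K` and some subgroup `N`. -/
def IsAbelianDirectFactor {G : Type*} [Group G] (K : Subgroup G) : Prop :=
  (∀ x ∈ K, ∀ y ∈ K, x * y = y * x) ∧
    ∃ N : Subgroup G, K.Normal ∧ N.Normal ∧ K ⊓ N = ⊥ ∧ K ⊔ N = ⊤

/-- A group is purely non-abelian if it has no non-trivial abelian direct factor. -/
def PurelyNonabelian (G : Type*) [Group G] : Prop :=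
  ∀ K : Subgroup G, IsAbelianDirectFactor K → K = ⊥

/-! ### The co-opposite dual group algebra -/

/-- The Hopf algebra `(k^G)^cop`: the functions `G → k` with pointwise multiplication and with the
co-opposite of the comultiplication dual to the multiplication of `G`. -/
def GroupDualCop (k G : Type*) : Type _ := G → k

namespace GroupDualCop

section Basic

variable {k G : Type*} [Field k]

instance : CommRing (GroupDualCop k G) := inferInstanceAs (CommRing (G → k))

instance : Algebra k (GroupDualCop k G) := inferInstanceAs (Algebra k (G → k))

/-- A function on `G` as an element of `(k^G)^cop`. -/
def of (f : G → k) : GroupDualCop k G := f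

/-- Evaluation of an element of `(k^G)^cop` at a group element. -/
def eval (a : GroupDualCop k G) (g : G) : k := a g

@[ext] theorem ext {a b : GroupDualCop k G} (h : ∀ g, a.eval g = b.eval g) : a = b := funext h

@[simp] theorem eval_of (f : G → k) (g : G) : (of f).eval g = f g := rfl

@[simp] theorem eval_add (a b : GroupDualCop k G) (g : G) :
    (a + b).eval g = a.eval g + b.eval g := rfl

@[simp] theorem eval_smul (c : k) (a : GroupDualCop k G) (g : G) :
    (c • a).eval g = c * a.eval g := rfl

@[simp] theorem eval_mul (a b : GroupDualCop k G) (g : G) :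
    (a * b).eval g = a.eval g * b.eval g := rfl

@[simp] theorem eval_one (g : G) : (1 : GroupDualCop k G).eval g = 1 := rfl

@[simp] theorem eval_zero (g : G) : (0 : GroupDualCop k G).eval g = 0 := rfl

@[simp] theorem eval_sum {ι : Type*} (s : Finset ι) (f : ι → GroupDualCop k G) (g : G) :
    (∑ i ∈ s, f i).eval g = ∑ i ∈ s, (f i).eval g := Finset.sum_apply g s f

end Basic

/-- The dual basis vector `e_g`. -/
def e {k G : Type*} [Field k] [DecidableEq G] (g : G) : GroupDualCop k G :=
  of fun x => if x = g then 1 else 0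

@[simp] theorem eval_e {k G : Type*} [Field k] [DecidableEq G] (g x : G) :
    (e g : GroupDualCop k G).eval x = if x = g then 1 else 0 := rfl

theorem sum_eval_smul_e {k G : Type*} [Field k] [Fintype G] [DecidableEq G]
    (a : GroupDualCop k G) : ∑ g, a.eval g • e g = a := by
  ext x
  simp

theorem sum_e {k G : Type*} [Field k] [Fintype G] [DecidableEq G] :
    ∑ g : G, (e g : GroupDualCop k G) = 1 := by
  ext x
  simp

theorem hom_ext {k G M : Type*} [Field k] [Fintype G] [DecidableEq G] [AddCommMonoid M]
    [Module k M] {f f' : GroupDualCop k G →ₗ[k] M} (h : ∀ g, f (e g) = f' (e g)) : f = f' := by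
  ext1 a
  rw [← sum_eval_smul_e a]
  simp [h]

theorem e_mul_e {k G : Type*} [Field k] [DecidableEq G] (g h : G) :
    (e g * e h : GroupDualCop k G) = if g = h then e g else 0 := by
  ext x
  by_cases hx : x = g <;> by_cases hg : g = h <;> simp_all

variable {k G : Type*} [Field k] [Group G] [Fintype G] [DecidableEq G]

/-- The comultiplication is `Δ(e_g) = ∑_{ab = g} e_b ⊗ e_a`, the counit is evaluation at `1`. -/
instance : CoalgebraStruct k (GroupDualCop k G) where
  comul :=
    { toFun := fun f => ∑ a : G, ∑ b : G, f.eval (a * b) • (e b ⊗ₜ[k] e a)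
      map_add' := fun f f' => by simp [add_smul, Finset.sum_add_distrib]
      map_smul' := fun c f => by simp [mul_smul, Finset.smul_sum] }
  counit :=
    { toFun := fun f => f.eval 1
      map_add' := fun f f' => eval_add f f' 1
      map_smul' := fun c f => eval_smul c f 1 }

theorem comul_def (f : GroupDualCop k G) :
    Coalgebra.comul (R := k) f = ∑ a : G, ∑ b : G, f.eval (a * b) • (e b ⊗ₜ[k] e a) := rfl

theorem counit_def (f : GroupDualCop k G) : Coalgebra.counit (R := k) f = f.eval 1 := rfl

theorem comul_e (g : G) :
    Coalgebra.comul (R := k) (e g : GroupDualCop k G) = ∑ a : G, e (a⁻¹ * g) ⊗ₜ[k] e a := by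
  rw [comul_def]
  refine Finset.sum_congr rfl fun a _ => ?_
  rw [Finset.sum_eq_single (a⁻¹ * g)]
  · simp
  · intro b _ hb
    have : a * b ≠ g := by rintro rfl; simp at hb
    simp [this]
  · simp

theorem counit_e (g : G) :
    Coalgebra.counit (R := k) (e g : GroupDualCop k G) = if 1 = g then 1 else 0 := rfl

instance : Coalgebra k (GroupDualCop k G) where
  coassoc := hom_ext fun g => by
    simp only [LinearMap.comp_apply, comul_e, map_sum, LinearMap.rTensor_tmul,
      LinearMap.lTensor_tmul, TensorProduct.sum_tmul, TensorProduct.tmul_sum,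
      LinearEquiv.coe_coe, TensorProduct.assoc_tmul]
    rw [Finset.sum_comm (f := fun a b => e (a⁻¹ * g) ⊗ₜ[k] (e (b⁻¹ * a) ⊗ₜ[k] e b))]
    refine Finset.sum_congr rfl fun b _ => ?_
    refine Fintype.sum_equiv (Equiv.mulLeft b) _ _ fun c => ?_
    simp [mul_assoc]
  rTensor_counit_comp_comul := hom_ext fun g => by
    simp only [LinearMap.comp_apply, comul_e, map_sum, LinearMap.rTensor_tmul, counit_e]
    rw [Finset.sum_eq_single g]
    · simp
    · intro b _ hb
      have : ¬ (1 = b⁻¹ * g) := fun h => hb (inv_mul_eq_one.mp h.symm)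
      simp [this]
    · simp
  lTensor_counit_comp_comul := hom_ext fun g => by
    simp only [LinearMap.comp_apply, comul_e, map_sum, LinearMap.lTensor_tmul, counit_e]
    rw [Finset.sum_eq_single 1]
    · simp
    · intro b _ hb
      simp [hb.symm]
    · simp

instance : Bialgebra k (GroupDualCop k G) where
  counit_one := rfl
  mul_compr₂_counit := rfl
  comul_one := by
    rw [comul_def, Algebra.TensorProduct.one_def]
    simp only [eval_one, one_smul, ← TensorProduct.sum_tmul, ← TensorProduct.tmul_sum]
    rw [sum_e]
  mul_compr₂_comul := hom_ext fun g => hom_ext fun h => by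
    simp only [LinearMap.compr₂_apply, LinearMap.compl₁₂_apply, LinearMap.mul_apply', e_mul_e,
      comul_e, Finset.sum_mul_sum, Algebra.TensorProduct.tmul_mul_tmul]
    by_cases hgh : g = h
    · subst hgh
      simp only [if_true, comul_e]
      refine Finset.sum_congr rfl fun a _ => ?_
      rw [Finset.sum_eq_single a]
      · simp
      · intro b _ hb
        simp [hb.symm]
      · simp
    · simp only [if_neg hgh, map_zero]
      symm
      refine Finset.sum_eq_zero fun a _ => Finset.sum_eq_zero fun b _ => ?_
      by_cases hab : a = b
      · subst hab
        simp [hgh]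
      · simp [hab]

/-- The antipode: `S(a)(g) = a(g⁻¹)`. -/
def antipodeMap : GroupDualCop k G →ₗ[k] GroupDualCop k G where
  toFun f := of fun g => f.eval g⁻¹
  map_add' _ _ := by ext; simp
  map_smul' _ _ := by ext; simp

theorem antipodeMap_e (g : G) : antipodeMap (e g : GroupDualCop k G) = e g⁻¹ := by
  ext y
  change (if y⁻¹ = g then (1 : k) else 0) = if y = g⁻¹ then 1 else 0
  simp only [inv_eq_iff_eq_inv]

instance : HopfAlgebra k (GroupDualCop k G) where
  antipode := antipodeMap
  mul_antipode_rTensor_comul := hom_ext fun g => by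
    simp only [LinearMap.comp_apply, comul_e, map_sum, LinearMap.rTensor_tmul, antipodeMap_e,
      LinearMap.mul'_apply, e_mul_e, counit_e, Algebra.linearMap_apply]
    by_cases hg : g = 1
    · subst hg
      simp [sum_e]
    · have h1 : ¬ 1 = g := fun h => hg h.symm
      simp [h1, hg]
  mul_antipode_lTensor_comul := hom_ext fun g => by
    simp only [LinearMap.comp_apply, comul_e, map_sum, LinearMap.lTensor_tmul, antipodeMap_e,
      LinearMap.mul'_apply, e_mul_e, counit_e, Algebra.linearMap_apply]
    by_cases hg : g = 1
    · subst hg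
      simp only [mul_one, if_true, map_one]
      exact (Equiv.sum_comp (Equiv.inv G) fun x => (e x : GroupDualCop k G)).trans sum_e
    · have h1 : ¬ 1 = g := fun h => hg h.symm
      simp [h1, hg]

end GroupDualCop

/-! ### The Drinfeld double -/

/-- The Drinfeld double `D(G)` over `k`. An element is represented by its coordinates with respect
to the basis `e_g # h` (`g, h ∈ G`). -/
def DrinfeldDouble (k G : Type*) : Type _ := G × G → k

namespace DrinfeldDouble

section Basic

variable {k G : Type*} [Field k]

instance : AddCommGroup (DrinfeldDouble k G) := inferInstanceAs (AddCommGroup (G × G → k))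

instance : Module k (DrinfeldDouble k G) := inferInstanceAs (Module k (G × G → k))

/-- The element of `D(G)` with given coordinates. -/
def of (f : G → G → k) : DrinfeldDouble k G := fun x => f x.1 x.2

/-- The coefficient of `e_g # h`. -/
def coeff (x : DrinfeldDouble k G) (g h : G) : k := x (g, h)

@[ext] theorem ext {x y : DrinfeldDouble k G} (h : ∀ g g', x.coeff g g' = y.coeff g g') : x = y :=
  funext fun p => h p.1 p.2

@[simp] theorem coeff_of (f : G → G → k) (g h : G) : (of f).coeff g h = f g h := rfl

@[simp] theorem coeff_add (x y : DrinfeldDouble k G) (g h : G) :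
    (x + y).coeff g h = x.coeff g h + y.coeff g h := rfl

@[simp] theorem coeff_smul (c : k) (x : DrinfeldDouble k G) (g h : G) :
    (c • x).coeff g h = c * x.coeff g h := rfl

@[simp] theorem coeff_zero (g h : G) : (0 : DrinfeldDouble k G).coeff g h = 0 := rfl

@[simp] theorem coeff_sum {ι : Type*} (s : Finset ι) (f : ι → DrinfeldDouble k G) (g h : G) :
    (∑ i ∈ s, f i).coeff g h = ∑ i ∈ s, (f i).coeff g h := Finset.sum_apply (g, h) s f

/-- The basis element `e_g # h`. -/
def E [DecidableEq G] (g h : G) : DrinfeldDouble k G :=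
  of fun x y => if x = g ∧ y = h then 1 else 0

@[simp] theorem coeff_E [DecidableEq G] (g h x y : G) :
    (E g h : DrinfeldDouble k G).coeff x y = if x = g ∧ y = h then 1 else 0 := rfl

theorem sum_coeff_smul_E [Fintype G] [DecidableEq G] (x : DrinfeldDouble k G) :
    ∑ g, ∑ h, x.coeff g h • E g h = x := by
  ext a b
  simp [ite_and]

theorem hom_ext [Fintype G] [DecidableEq G] {M : Type*} [AddCommMonoid M] [Module k M]
    {f f' : DrinfeldDouble k G →ₗ[k] M} (h : ∀ g g', f (E g g') = f' (E g g')) : f = f' := by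
  ext1 x
  rw [← sum_coeff_smul_E x]
  simp [h]

end Basic

variable {k G : Type*} [Field k] [Group G] [Fintype G] [DecidableEq G]

/-- The bilinear extension of `(e_g # g')(e_h # h') = δ_{g, g' h g'⁻¹} e_g # g'h'`; see `E_mul_E`. -/
instance : Mul (DrinfeldDouble k G) where
  mul x y := of fun g h => ∑ s, x.coeff g s * y.coeff (s⁻¹ * g * s) (s⁻¹ * h)

/-- The unit is `ε # 1`, where `ε = ∑_g e_g`. -/
instance : One (DrinfeldDouble k G) where
  one := of fun _ h => if h = 1 then 1 else 0

theorem coeff_mul (x y : DrinfeldDouble k G) (g h : G) :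
    (x * y).coeff g h = ∑ s, x.coeff g s * y.coeff (s⁻¹ * g * s) (s⁻¹ * h) := rfl

theorem coeff_one (g h : G) : (1 : DrinfeldDouble k G).coeff g h = if h = 1 then 1 else 0 := rfl

theorem E_mul_E (g g' h h' : G) :
    (E g g' * E h h' : DrinfeldDouble k G) =
      if g = g' * h * g'⁻¹ then E g (g' * h') else 0 := by
  ext x y
  rw [coeff_mul, Finset.sum_eq_single g']
  · by_cases hg : g = g' * h * g'⁻¹
    · subst hg
      simp only [coeff_E, and_true, if_true, inv_mul_eq_iff_eq_mul]
      by_cases hx : x = g' * h * g'⁻¹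
      · subst hx
        simp [mul_assoc]
      · simp [hx]
    · simp only [coeff_E, and_true, if_neg hg, coeff_zero]
      by_cases hx : x = g
      · subst hx
        have : ¬ (g'⁻¹ * x * g' = h) := by
          rintro rfl
          exact hg (by group)
        simp [this]
      · simp [hx]
  · intro s _ hs
    simp [hs]
  · simp

theorem one_eq_sum : (1 : DrinfeldDouble k G) = ∑ g, E g 1 := by
  ext x y
  simp [coeff_one, ite_and]

instance : Ring (DrinfeldDouble k G) :=
  { (inferInstance : AddCommGroup (DrinfeldDouble k G)) with
    mul := (· * ·)
    one := 1
    zero_mul := fun x => by ext; simp [coeff_mul]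
    mul_zero := fun x => by ext; simp [coeff_mul]
    left_distrib := fun x y z => by ext; simp [coeff_mul, mul_add, Finset.sum_add_distrib]
    right_distrib := fun x y z => by ext; simp [coeff_mul, add_mul, Finset.sum_add_distrib]
    one_mul := fun x => by ext; simp [coeff_mul, coeff_one]
    mul_one := fun x => by
      ext g h
      rw [coeff_mul, Finset.sum_eq_single h]
      · simp [coeff_one]
      · intro s _ hs
        have : ¬ (s⁻¹ * h = 1) := fun h' => hs (inv_mul_eq_one.mp h')
        simp [coeff_one, this]
      · simp
    mul_assoc := fun x y z => by
      ext g h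
      simp only [coeff_mul, Finset.sum_mul, Finset.mul_sum]
      rw [Finset.sum_comm]
      refine Finset.sum_congr rfl fun t _ => ?_
      refine (Fintype.sum_equiv (Equiv.mulLeft t) _ _ fun s => ?_).symm
      simp [mul_assoc] }

instance : Algebra k (DrinfeldDouble k G) :=
  Algebra.ofModule
    (fun c x y => by ext; simp [coeff_mul, Finset.mul_sum, mul_assoc])
    (fun c x y => by ext; simp [coeff_mul, Finset.mul_sum, mul_left_comm])

/-- The coalgebra structure is that of `(k^G)^cop ⊗ kG`: the comultiplication is
`Δ(e_g # h) = ∑_{ab = g} (e_b # h) ⊗ (e_a # h)` and the counit is `ε(e_g # h) = δ_{g,1}`. -/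
instance : CoalgebraStruct k (DrinfeldDouble k G) where
  comul :=
    { toFun := fun x => ∑ h : G, ∑ a : G, ∑ b : G, x.coeff (a * b) h • (E b h ⊗ₜ[k] E a h)
      map_add' := fun x y => by simp [add_smul, Finset.sum_add_distrib]
      map_smul' := fun c x => by simp [mul_smul, Finset.smul_sum] }
  counit :=
    { toFun := fun x => ∑ h : G, x.coeff 1 h
      map_add' := fun x y => by simp [Finset.sum_add_distrib]
      map_smul' := fun c x => by simp [Finset.mul_sum] }

theorem comul_def (x : DrinfeldDouble k G) : Coalgebra.comul (R := k) x =
    ∑ h : G, ∑ a : G, ∑ b : G, x.coeff (a * b) h • (E b h ⊗ₜ[k] E a h) := rfl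

theorem counit_def (x : DrinfeldDouble k G) :
    Coalgebra.counit (R := k) x = ∑ h : G, x.coeff 1 h := rfl

theorem comul_E (g h : G) : Coalgebra.comul (R := k) (E g h : DrinfeldDouble k G) =
    ∑ a : G, E (a⁻¹ * g) h ⊗ₜ[k] E a h := by
  rw [comul_def, Finset.sum_eq_single h]
  · refine Finset.sum_congr rfl fun a _ => ?_
    rw [Finset.sum_eq_single (a⁻¹ * g)]
    · simp
    · intro b _ hb
      have : a * b ≠ g := by rintro rfl; simp at hb
      simp [this]
    · simp
  · intro s _ hs
    simp [hs]
  · simp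

theorem counit_E (g h : G) :
    Coalgebra.counit (R := k) (E g h : DrinfeldDouble k G) = if g = 1 then 1 else 0 := by
  by_cases hg : g = 1
  · subst hg
    simp [counit_def]
  · have h1 : ¬ 1 = g := fun h => hg h.symm
    simp [counit_def, hg, h1]

instance : Coalgebra k (DrinfeldDouble k G) where
  coassoc := hom_ext fun g h => by
    simp only [LinearMap.comp_apply, comul_E, map_sum, LinearMap.rTensor_tmul,
      LinearMap.lTensor_tmul, TensorProduct.sum_tmul, TensorProduct.tmul_sum,
      LinearEquiv.coe_coe, TensorProduct.assoc_tmul]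
    rw [Finset.sum_comm (f := fun a b => E (a⁻¹ * g) h ⊗ₜ[k] (E (b⁻¹ * a) h ⊗ₜ[k] E b h))]
    refine Finset.sum_congr rfl fun b _ => ?_
    refine Fintype.sum_equiv (Equiv.mulLeft b) _ _ fun c => ?_
    simp [mul_assoc]
  rTensor_counit_comp_comul := hom_ext fun g h => by
    simp only [LinearMap.comp_apply, comul_E, map_sum, LinearMap.rTensor_tmul, counit_E]
    rw [Finset.sum_eq_single g]
    · simp
    · intro b _ hb
      have : ¬ (b⁻¹ * g = 1) := fun h => hb (inv_mul_eq_one.mp h)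
      simp [this]
    · simp
  lTensor_counit_comp_comul := hom_ext fun g h => by
    simp only [LinearMap.comp_apply, comul_E, map_sum, LinearMap.lTensor_tmul, counit_E]
    rw [Finset.sum_eq_single 1]
    · simp
    · intro b _ hb
      simp [hb]
    · simp

instance : Bialgebra k (DrinfeldDouble k G) where
  counit_one := by simp [one_eq_sum, counit_E]
  mul_compr₂_counit := hom_ext fun g g' => hom_ext fun h h' => by
    simp only [LinearMap.compr₂_apply, LinearMap.compl₁₂_apply, LinearMap.mul_apply', E_mul_E,
      counit_E]
    by_cases hg : g = 1
    · subst hg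
      by_cases hh : h = 1
      · subst hh
        simp [counit_E]
      · have : ¬ (1 = g' * h * g'⁻¹) := fun h1 => hh (conj_eq_one_iff.mp h1.symm)
        simp [this, hh]
    · by_cases hc : g = g' * h * g'⁻¹
      · rw [if_pos hc]
        simp [hg, counit_E]
      · simp [hc, hg]
  comul_one := by
    rw [comul_def, Algebra.TensorProduct.one_def, Finset.sum_eq_single 1]
    · simp only [coeff_one, if_true, one_smul, ← TensorProduct.sum_tmul,
        ← TensorProduct.tmul_sum]
      rw [one_eq_sum]
    · intro s _ hs
      simp [coeff_one, hs]
    · simp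
  mul_compr₂_comul := hom_ext fun g g' => hom_ext fun h h' => by
    simp only [LinearMap.compr₂_apply, LinearMap.compl₁₂_apply, LinearMap.mul_apply', E_mul_E,
      comul_E, Finset.sum_mul_sum, Algebra.TensorProduct.tmul_mul_tmul]
    have key : ∀ a : G, (∑ b : G,
        (if a⁻¹ * g = g' * (b⁻¹ * h) * g'⁻¹ then (E (a⁻¹ * g) (g' * h') : DrinfeldDouble k G)
          else 0) ⊗ₜ[k]
        (if a = g' * b * g'⁻¹ then (E a (g' * h') : DrinfeldDouble k G) else 0)) =
        if g = g' * h * g'⁻¹ then E (a⁻¹ * g) (g' * h') ⊗ₜ[k] E a (g' * h') else 0 := by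
      intro a
      rw [Finset.sum_eq_single (g'⁻¹ * a * g')]
      · have h1 : a = g' * (g'⁻¹ * a * g') * g'⁻¹ := by group
        have h2 : g' * ((g'⁻¹ * a * g')⁻¹ * h) * g'⁻¹ = a⁻¹ * (g' * h * g'⁻¹) := by group
        rw [if_pos h1, h2]
        simp only [mul_right_inj]
        split_ifs <;> simp
      · intro b _ hb
        have : ¬ (a = g' * b * g'⁻¹) := by
          rintro rfl
          exact hb (by group)
        rw [if_neg this, TensorProduct.tmul_zero]
      · simp
    simp only [key]
    by_cases hg : g = g' * h * g'⁻¹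
    · simp only [if_pos hg, comul_E]
    · simp only [if_neg hg, map_zero, Finset.sum_const_zero]

/-- The antipode on coordinates; see `antipode_E`. -/
def antipodeMap : DrinfeldDouble k G →ₗ[k] DrinfeldDouble k G where
  toFun x := of fun g h => x.coeff (h⁻¹ * g⁻¹ * h) h⁻¹
  map_add' _ _ := by ext; simp
  map_smul' _ _ := by ext; simp

theorem antipodeMap_E (g h : G) :
    antipodeMap (E g h : DrinfeldDouble k G) = E (h⁻¹ * g⁻¹ * h) h⁻¹ := by
  ext x y
  change (if y⁻¹ * x⁻¹ * y = g ∧ y⁻¹ = h then (1 : k) else 0) = _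
  simp only [coeff_E]
  by_cases hy : y = h⁻¹
  · subst hy
    have : h * x⁻¹ * h⁻¹ = g ↔ x = h⁻¹ * g⁻¹ * h := by
      constructor
      · rintro rfl; group
      · rintro rfl; group
    simp [this]
  · have : ¬ (y⁻¹ = h) := fun h' => hy (inv_eq_iff_eq_inv.mp h')
    simp [hy, this]

instance : HopfAlgebra k (DrinfeldDouble k G) where
  antipode := antipodeMap
  mul_antipode_rTensor_comul := hom_ext fun g h => by
    simp only [LinearMap.comp_apply, comul_E, map_sum, LinearMap.rTensor_tmul, antipodeMap_E,
      LinearMap.mul'_apply, E_mul_E, counit_E, Algebra.linearMap_apply]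
    by_cases hg : g = 1
    · subst hg
      simp only [mul_one, inv_inv, if_true, inv_mul_cancel, map_one, one_eq_sum]
      exact Fintype.sum_equiv (MulAut.conj h⁻¹).toEquiv _ _ fun a => by simp
    · rw [if_neg hg, map_zero]
      refine Finset.sum_eq_zero fun a _ => if_neg fun h' => hg ?_
      simpa [mul_assoc] using h'
  mul_antipode_lTensor_comul := hom_ext fun g h => by
    simp only [LinearMap.comp_apply, comul_E, map_sum, LinearMap.lTensor_tmul, antipodeMap_E,
      LinearMap.mul'_apply, E_mul_E, counit_E, Algebra.linearMap_apply]
    by_cases hg : g = 1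
    · subst hg
      simp only [mul_one, if_true, mul_inv_cancel, map_one, one_eq_sum]
      refine Fintype.sum_equiv (Equiv.inv G) _ _ fun a => ?_
      rw [if_pos (by group)]
      simp
    · rw [if_neg hg, map_zero]
      refine Finset.sum_eq_zero fun a _ => if_neg fun h' => hg ?_
      have h2 : h * (h⁻¹ * a⁻¹ * h) * h⁻¹ = a⁻¹ * 1 := by group
      exact mul_left_cancel (h'.trans h2)

theorem antipode_E (g h : G) :
    HopfAlgebra.antipode k (E g h : DrinfeldDouble k G) = E (h⁻¹ * g⁻¹ * h) h⁻¹ :=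
  antipodeMap_E g h

/-! ### The components of a morphism of doubles -/

/-- The element `a # x` of `D(G)`, for `a ∈ k^G` and `x ∈ kG`. -/
def hashTmul (a : GroupDualCop k G) (x : MonoidAlgebra k G) : DrinfeldDouble k G :=
  of fun g h => a.eval g * x.coeff h

theorem hashTmul_e_single (g h : G) :
    hashTmul (GroupDualCop.e g : GroupDualCop k G) (MonoidAlgebra.single h 1) = E g h := by
  ext x y
  by_cases hx : x = g <;> by_cases hy : h = y <;>
    simp [hashTmul, hx, hy, eq_comm (a := y), Finsupp.single_apply]

/-- The inclusion `k^G → D(G)`, `a ↦ a # 1`. -/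
def inclDual : GroupDualCop k G →ₗ[k] DrinfeldDouble k G where
  toFun a := hashTmul a 1
  map_add' a b := by ext; simp [hashTmul, add_mul]
  map_smul' c a := by ext; simp [hashTmul, mul_assoc]

/-- The inclusion `kG → D(G)`, `x ↦ ε # x`. -/
def inclGroup : MonoidAlgebra k G →ₗ[k] DrinfeldDouble k G where
  toFun x := hashTmul 1 x
  map_add' x y := by ext; simp [hashTmul]
  map_smul' c x := by ext; simp [hashTmul]

/-- The projection `id ⊗ ε : D(G) → k^G`, that is `e_g # h ↦ e_g`. -/
def projDual : DrinfeldDouble k G →ₗ[k] GroupDualCop k G where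
  toFun x := GroupDualCop.of fun g => ∑ h, x.coeff g h
  map_add' x y := by ext; simp [Finset.sum_add_distrib]
  map_smul' c x := by ext; simp [Finset.mul_sum]

/-- The projection `ev_1 ⊗ id : D(G) → kG`, that is `e_g # h ↦ δ_{g,1} h`. -/
def projGroup : DrinfeldDouble k G →ₗ[k] MonoidAlgebra k G where
  toFun x := ∑ h, x.coeff 1 h • MonoidAlgebra.single h 1
  map_add' x y := by simp only [coeff_add, add_smul, Finset.sum_add_distrib]
  map_smul' c x := by simp only [coeff_smul, mul_smul, Finset.smul_sum, RingHom.id_apply]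

theorem projDual_E (g h : G) : projDual (E g h : DrinfeldDouble k G) = GroupDualCop.e g := by
  ext x
  simp [projDual, ite_and]

theorem projGroup_E (g h : G) : projGroup (E g h : DrinfeldDouble k G) =
    if g = 1 then MonoidAlgebra.single h 1 else 0 := by
  by_cases hg : g = 1
  · subst hg
    simp only [projGroup, LinearMap.coe_mk, AddHom.coe_mk, coeff_E, true_and, if_true]
    rw [Finset.sum_eq_single h]
    · simp
    · intro b _ hb
      simp [hb]
    · simp
  · have : ¬ 1 = g := fun h => hg h.symm
    simp [projGroup, hg, this]

variable {H : Type*} [Group H] [Fintype H] [DecidableEq H]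

/-- The component `u : k^G → k^H`, `u(a) = (id ⊗ ε)(ψ(a # 1))`, of a morphism
`ψ = (p, u, r, v) : D(G) → D(H)`. -/
def compU (ψ : DrinfeldDouble k G →ₐc[k] DrinfeldDouble k H) :
    GroupDualCop k G →ₗ[k] GroupDualCop k H :=
  projDual ∘ₗ (ψ : DrinfeldDouble k G →ₗ[k] DrinfeldDouble k H) ∘ₗ inclDual

/-- The component `p : k^G → kH`, `p(a) = (ev_1 ⊗ id)(ψ(a # 1))`. -/
def compP (ψ : DrinfeldDouble k G →ₐc[k] DrinfeldDouble k H) :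
    GroupDualCop k G →ₗ[k] MonoidAlgebra k H :=
  projGroup ∘ₗ (ψ : DrinfeldDouble k G →ₗ[k] DrinfeldDouble k H) ∘ₗ inclDual

/-- The component `r : kG → k^H`, `r(x) = (id ⊗ ε)(ψ(ε # x))`. -/
def compR (ψ : DrinfeldDouble k G →ₐc[k] DrinfeldDouble k H) :
    MonoidAlgebra k G →ₗ[k] GroupDualCop k H :=
  projDual ∘ₗ (ψ : DrinfeldDouble k G →ₗ[k] DrinfeldDouble k H) ∘ₗ inclGroup

/-- The component `v : kG → kH`, `v(x) = (ev_1 ⊗ id)(ψ(ε # x))`. -/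
def compV (ψ : DrinfeldDouble k G →ₐc[k] DrinfeldDouble k H) :
    MonoidAlgebra k G →ₗ[k] MonoidAlgebra k H :=
  projGroup ∘ₗ (ψ : DrinfeldDouble k G →ₗ[k] DrinfeldDouble k H) ∘ₗ inclGroup

end DrinfeldDouble

/-! ### Linear duals -/

namespace GroupDualCop

variable {k G H : Type*} [Field k] [Fintype G] [DecidableEq G] [Fintype H] [DecidableEq H]

/-- The evaluation pairing `⟨a, x⟩` of `a ∈ k^G` with `x ∈ kG`. -/
def pairing (a : GroupDualCop k G) (x : MonoidAlgebra k G) : k := ∑ g, a.eval g * x.coeff g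

/-- The linear dual `f^* : kH → kG` of a linear map `f : k^G → k^H`, determined by
`⟨a, f^*(x)⟩ = ⟨f(a), x⟩`; see `pairing_dualMap`. -/
def dualMap (f : GroupDualCop k G →ₗ[k] GroupDualCop k H) :
    MonoidAlgebra k H →ₗ[k] MonoidAlgebra k G where
  toFun x := ∑ g : G, pairing (f (e g)) x • MonoidAlgebra.single g 1
  map_add' x y := by
    simp only [pairing, MonoidAlgebra.coeff_add, Finsupp.add_apply, mul_add,
      Finset.sum_add_distrib, add_smul]
  map_smul' c x := by
    simp only [pairing, MonoidAlgebra.coeff_smul, Finsupp.smul_apply, smul_eq_mul,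
      mul_left_comm _ c, ← Finset.mul_sum, mul_smul, ← Finset.smul_sum, RingHom.id_apply]

theorem pairing_dualMap (f : GroupDualCop k G →ₗ[k] GroupDualCop k H) (a : GroupDualCop k G)
    (x : MonoidAlgebra k H) : pairing a (dualMap f x) = pairing (f a) x := by
  have h1 : ∀ g, (dualMap f x).coeff g = pairing (f (e g)) x := by
    intro g
    simp [dualMap, Finsupp.single_apply]
  have h2 : f a = ∑ g, a.eval g • f (e g) := by
    conv_lhs => rw [← sum_eval_smul_e a]
    simp
  rw [h2]
  simp only [pairing, h1, eval_sum, eval_smul, Finset.mul_sum, Finset.sum_mul]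
  rw [Finset.sum_comm]
  simp only [mul_assoc]

end GroupDualCop

end

/-! By a Fitting argument it suffices to invert `u^*` and `v` modulo the centre. Let `ψ'` be the
inverse of `ψ`, with its components primed. If endomorphisms `α`, `α'` of a finite group satisfy `x
(α' (α x))⁻¹ ∈ Z(G)` for all `x`, then some power `f` of `α' ∘ α` is idempotent and still the
identity modulo the centre. Hence `G` is the direct product of `ker f`, which is central and
contains `ker α`, and `im f`.

Since `ψ` preserves group-like elements, `ψ(ε # g) = χ_g # β(g)` with `χ_g` a linear character, so
`v` restricts to `β`. Applying `ψ'` gives `g = p'(χ_g) · β'(β(g))`, so the defect of `β' ∘ β` lies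
in the image of `p'`. The defect of `α' ∘ α` at `x` is likewise an element `b` with `p'(e_b) ≠ 0`.

Everything therefore rests on `p` being central on both sides: `p(e_b) ≠ 0` forces `b ∈ Z(G)`
(`mem_center_of_compP_ne_zero`), and the image of `p` lies in the centre of `kG`
(`compP_commute_of`). The source of this is that `ψ(a # 1)` is the convolution of `u` and `p` in
either order; comparing the two orders shows that `u` is invariant under conjugation by such `b`
(`compU_e_conj`). Centrality of the support of `p(e_g)` also makes `u` multiplicative, hence dual to
a group endomorphism `α`. -/

noncomputable section

/-! ### Endomorphisms that are the identity modulo the centre -/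

section Fitting

variable {G : Type*} [Group G] [Finite G]

/-- Every element of a finite monoid has an idempotent power. -/
theorem exists_pow_idempotent_of_finite {M : Type*} [Monoid M] [Finite M] (x : M) :
    ∃ n, n ≠ 0 ∧ x ^ n * x ^ n = x ^ n := by
  obtain ⟨a, d, hd, hx⟩ : ∃ a d, d ≠ 0 ∧ x ^ (a + d) = x ^ a := by
    obtain ⟨i, j, hij, h⟩ := Finite.exists_ne_map_eq_of_infinite fun n : ℕ => x ^ n
    rcases Nat.lt_or_gt_of_ne hij with hlt | hlt
    · exact ⟨i, j - i, by omega, by rw [Nat.add_sub_cancel' hlt.le]; exact h.symm⟩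
    · exact ⟨j, i - j, by omega, by rw [Nat.add_sub_cancel' hlt.le]; exact h⟩
  have hmul : ∀ m, x ^ (a + d * m) = x ^ a := by
    intro m
    induction m with
    | zero => simp
    | succ m ih => rw [Nat.mul_succ, ← add_assoc, pow_add, ih, ← pow_add, hx]
  -- The exponent must be a multiple of the period `d` and at least the preperiod `a`; the summand
  -- `1` keeps it nonzero.
  refine ⟨d * (a + 1), by positivity, ?_⟩
  obtain ⟨c, hc⟩ : ∃ c, d * (a + 1) = c + a :=
    ⟨d * (a + 1) - a, by have := Nat.le_mul_of_pos_left (a + 1) (Nat.pos_of_ne_zero hd); omega⟩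
  calc x ^ (d * (a + 1)) * x ^ (d * (a + 1)) = x ^ c * x ^ (a + d * (a + 1)) := by
        rw [← pow_add, ← pow_add]; congr 1; omega
    _ = x ^ (d * (a + 1)) := by rw [hmul, ← pow_add, hc]

/-- Fitting decomposition: if `α' ∘ α` is the identity modulo the centre, then the kernel of `α`
is contained in an abelian direct factor. -/
theorem exists_isAbelianDirectFactor_ker_le (α α' : G →* G)
    (h : ∀ x, x * (α' (α x))⁻¹ ∈ Subgroup.center G) :
    ∃ K : Subgroup G, IsAbelianDirectFactor K ∧ α.ker ≤ K := by
  let φ : Monoid.End G := α'.comp α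
  have hφ : ∀ n x, x * ((φ ^ n) x)⁻¹ ∈ Subgroup.center G := by
    intro n
    induction n with
    | zero => intro x; simp
    | succ n ih =>
      intro x
      have h1 := mul_mem (ih x) (h ((φ ^ n) x))
      have h2 : (φ ^ (n + 1)) x = α' (α ((φ ^ n) x)) := by rw [pow_succ']; rfl
      rw [h2]
      simpa [mul_assoc] using h1
  have hker : ∀ n, n ≠ 0 → ∀ x ∈ α.ker, (φ ^ n) x = 1 := by
    rintro (_ | n) hn x hx
    · exact absurd rfl hn
    · have h2 : (φ ^ (n + 1)) x = (φ ^ n) (α' (α x)) := by rw [pow_succ]; rfl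
      rw [h2, hx]
      simp
  have : Finite (Monoid.End G) := Finite.of_injective _ (DFunLike.coe_injective (F := G →* G))
  -- An idempotent `f` splits `G` as `ker f` times `range f`. As `f` is still the identity modulo
  -- the centre, its kernel is central.
  obtain ⟨n, hn, hidem⟩ := exists_pow_idempotent_of_finite φ
  set f : G →* G := φ ^ n with hf
  have hff : ∀ x, f (f x) = f x := fun x => DFunLike.congr_fun hidem x
  have hc : ∀ x, x * (f x)⁻¹ ∈ Subgroup.center G := hφ n
  have hkc : ∀ x ∈ f.ker, x ∈ Subgroup.center G := fun x hx => by
    have h1 := hc x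
    rw [MonoidHom.mem_ker.mp hx] at h1
    simpa using h1
  refine ⟨f.ker, ⟨fun x hx y _ => ((Subgroup.mem_center_iff.mp (hkc x hx)) y).symm, f.range,
    inferInstance, ⟨?_⟩, ?_, ?_⟩, fun x hx => hker n hn x hx⟩
  · rintro _ ⟨x, rfl⟩ g
    refine ⟨g * x * g⁻¹, ?_⟩
    -- The range is normal because `g` and `f g` differ by a central element and so conjugate alike.
    have h1 := Subgroup.mem_center_iff.mp (hc g) (f g * f x * (f g)⁻¹)
    rw [map_mul, map_mul, map_inv]
    calc f g * f x * (f g)⁻¹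
        = f g * f x * (f g)⁻¹ * (g * (f g)⁻¹) * (g * (f g)⁻¹)⁻¹ := by group
      _ = g * f x * g⁻¹ := by rw [h1]; group
  · rw [eq_bot_iff]
    rintro _ ⟨hy, x, rfl⟩
    have h1 : f (f x) = 1 := hy
    rwa [hff] at h1
  · rw [eq_top_iff]
    intro x _
    have h1 : x * (f x)⁻¹ ∈ f.ker := by simp [MonoidHom.mem_ker, hff]
    simpa using Subgroup.mul_mem_sup h1 (f.mem_range.mpr ⟨x, rfl⟩)

end Fitting

/-- A family of orthogonal idempotents of a field summing to one is a standard basis vector. -/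
theorem exists_eq_ite_of_orthogonal {k ι : Type*} [Field k] [Fintype ι] [DecidableEq ι]
    (f : ι → k) (hf : ∀ i j, f i * f j = if i = j then f i else 0) (hs : ∑ i, f i = 1) :
    ∃ i, ∀ j, f j = if j = i then 1 else 0 := by
  obtain ⟨i, -, hi⟩ : ∃ i ∈ Finset.univ, f i ≠ 0 :=
    Finset.exists_ne_zero_of_sum_ne_zero (by rw [hs]; exact one_ne_zero)
  refine ⟨i, fun j => ?_⟩
  by_cases hj : j = i
  · subst hj
    rw [if_pos rfl]
    exact mul_left_cancel₀ hi (by rw [hf, if_pos rfl, mul_one])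
  · rw [if_neg hj]
    have := hf j i
    rw [if_neg hj] at this
    exact (mul_eq_zero.mp this).resolve_right hi

namespace DrinfeldDouble

variable {k G : Type*} [Field k] [Group G] [Fintype G] [DecidableEq G]

/-! ### Coordinates of the comultiplication -/

/-- The coordinate `x ↦ x.coeff g h` as a linear functional. -/
def coeffLin (g h : G) : DrinfeldDouble k G →ₗ[k] k where
  toFun x := x.coeff g h
  map_add' _ _ := rfl
  map_smul' _ _ := rfl

theorem coeffLin_apply (g h : G) (x : DrinfeldDouble k G) : coeffLin g h x = x.coeff g h := rfl

/-- The convolution product of two linear functionals. -/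
def convolve (f f' : DrinfeldDouble k G →ₗ[k] k) : DrinfeldDouble k G →ₗ[k] k :=
  LinearMap.mul' k k ∘ₗ TensorProduct.map f f' ∘ₗ Coalgebra.comul

theorem convolve_E (f f' : DrinfeldDouble k G →ₗ[k] k) (g h : G) :
    convolve f f' (E g h) = ∑ s : G, f (E (s⁻¹ * g) h) * f' (E s h) := by
  simp [convolve, comul_E]

/-- In the algebra dual to `D(G)` the first indices multiply as in `G`, reversed because of the
co-opposite, and the second indices behave as orthogonal idempotents. -/
theorem convolve_coeffLin (a b h h' : G) (x : DrinfeldDouble k G) :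
    convolve (coeffLin b h) (coeffLin a h') x = if h = h' then x.coeff (a * b) h else 0 := by
  have : convolve (coeffLin b h) (coeffLin a h') =
      if h = h' then (coeffLin (a * b) h : DrinfeldDouble k G →ₗ[k] k) else 0 := by
    refine hom_ext fun g t => ?_
    rw [convolve_E, Finset.sum_eq_single a]
    · by_cases hh : h = h'
      · subst hh
        simp only [coeffLin_apply, coeff_E, if_true, eq_inv_mul_iff_mul_eq]
        by_cases ht : h = t <;> simp [ht]
      · simp only [coeffLin_apply, coeff_E, if_neg hh, LinearMap.zero_apply]
        by_cases ht : h = t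
        · subst ht
          simp [Ne.symm hh]
        · simp [ht]
    · intro s _ hs
      simp [coeffLin_apply, hs.symm]
    · simp
  rw [this]
  split_ifs <;> rfl

theorem convolve_map (ψ : DrinfeldDouble k G →ₐc[k] DrinfeldDouble k G)
    (f f' : DrinfeldDouble k G →ₗ[k] k) (x : DrinfeldDouble k G) :
    convolve f f' (ψ x) = convolve (f ∘ₗ (ψ : DrinfeldDouble k G →ₗ[k] DrinfeldDouble k G))
      (f' ∘ₗ (ψ : DrinfeldDouble k G →ₗ[k] DrinfeldDouble k G)) x := by
  simp only [convolve, LinearMap.comp_apply, TensorProduct.map_comp]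
  rw [← CoalgHomClass.map_comp_comul_apply]

/-- Compatibility of `ψ` with comultiplication, in coordinates. All convolution identities for `u`
and `p` are partial sums or special cases of it. -/
theorem sum_coeff_mul_coeff (ψ : DrinfeldDouble k G →ₐc[k] DrinfeldDouble k G)
    (g t a b h h' : G) :
    ∑ s : G, (ψ (E (s⁻¹ * g) t)).coeff b h * (ψ (E s t)).coeff a h' =
      if h = h' then (ψ (E g t)).coeff (a * b) h else 0 := by
  rw [← convolve_coeffLin, convolve_map, convolve_E]
  rfl

/-! ### Group-like elements -/

/-- The element `χ # h` of `D(G)`, for a linear character `χ` of `G` and `h ∈ G`. -/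
def charElem (χ : G →* k) (h : G) : DrinfeldDouble k G :=
  of fun x y => if y = h then χ x else 0

theorem coeff_charElem (χ : G →* k) (h x y : G) :
    (charElem χ h).coeff x y = if y = h then χ x else 0 := rfl

theorem charElem_one_eq_sum (h : G) : (charElem 1 h : DrinfeldDouble k G) = ∑ g, E g h := by
  ext x y
  simp [coeff_charElem, ite_and]

theorem map_conj_eq (χ : G →* k) (s x : G) : χ (s⁻¹ * x * s) = χ x := by
  rw [map_mul, map_mul, mul_right_comm, ← map_mul, inv_mul_cancel, map_one, one_mul]

theorem coeff_charElem_mul (χ : G →* k) (t : G) (w : DrinfeldDouble k G) (x y : G) :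
    (charElem χ t * w).coeff x y = χ x * w.coeff (t⁻¹ * x * t) (t⁻¹ * y) := by
  rw [coeff_mul, Finset.sum_eq_single t]
  · simp [coeff_charElem]
  · intro s _ hs
    simp [coeff_charElem, hs]
  · simp

theorem coeff_mul_charElem (χ : G →* k) (t : G) (w : DrinfeldDouble k G) (x y : G) :
    (w * charElem χ t).coeff x y = w.coeff x (y * t⁻¹) * χ x := by
  rw [coeff_mul, Finset.sum_eq_single (y * t⁻¹)]
  · rw [coeff_charElem, map_conj_eq, if_pos (by group)]
  · intro s _ hs
    have : ¬ (s⁻¹ * y = t) := by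
      rintro rfl
      exact hs (by group)
    simp [coeff_charElem, this]
  · simp

theorem charElem_mul_charElem (χ χ' : G →* k) (h h' : G) :
    charElem χ h * charElem χ' h' = charElem (χ * χ') (h * h') := by
  ext x y
  rw [coeff_charElem_mul, coeff_charElem, coeff_charElem, map_conj_eq]
  simp [inv_mul_eq_iff_eq_mul]

theorem E_mul_charElem_one (g h : G) : E g 1 * charElem 1 h = (E g h : DrinfeldDouble k G) := by
  ext x y
  simp [coeff_mul_charElem, mul_inv_eq_one]

theorem charElem_one_mul_E (g h : G) :
    charElem 1 h * E g 1 = (E (h * g * h⁻¹) 1 * charElem 1 h : DrinfeldDouble k G) := by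
  rw [E_mul_charElem_one]
  ext x y
  have : h⁻¹ * x * h = g ↔ x = h * g * h⁻¹ := by
    constructor
    · rintro rfl; group
    · rintro rfl; group
  simp [coeff_charElem_mul, this, inv_mul_eq_one, eq_comm (a := h)]

theorem isGroupLikeElem_charElem_one (h : G) :
    IsGroupLikeElem k (charElem 1 h : DrinfeldDouble k G) where
  counit_eq_one := by simp [charElem_one_eq_sum, counit_E]
  comul_eq_tmul_self := by
    rw [charElem_one_eq_sum]
    simp only [map_sum, comul_E, TensorProduct.sum_tmul, TensorProduct.tmul_sum]
    rw [Finset.sum_comm]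
    refine Finset.sum_congr rfl fun a _ => ?_
    exact Fintype.sum_equiv (Equiv.mulLeft a⁻¹) _ _ fun c => rfl

/-- Coordinate functionals multiply on a group-like element. Those with first index `1` are
orthogonal idempotents with sum the counit, which selects one `h`; the coordinates over that `h`
then form a character. -/
theorem IsGroupLikeElem.exists_eq_charElem {z : DrinfeldDouble k G} (hz : IsGroupLikeElem k z) :
    ∃ (χ : G →* k) (h : G), z = charElem χ h := by
  have hmul : ∀ a b h h' : G, z.coeff b h * z.coeff a h' =
      if h = h' then z.coeff (a * b) h else 0 := by
    intro a b h h'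
    rw [← convolve_coeffLin, convolve, LinearMap.comp_apply, LinearMap.comp_apply,
      hz.comul_eq_tmul_self]
    rfl
  obtain ⟨t, ht⟩ := exists_eq_ite_of_orthogonal (fun h => z.coeff 1 h)
    (fun h h' => by rw [hmul, mul_one]) (by rw [← counit_def, hz.counit_eq_one])
  refine ⟨{ toFun := fun x => z.coeff x t, map_one' := by simp [ht], map_mul' := fun a b => ?_ },
    t, ?_⟩
  · rw [mul_comm, hmul, if_pos rfl]
  · ext x y
    rw [coeff_charElem]
    by_cases hy : y = t
    · subst hy
      simp
    · rw [if_neg hy]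
      have := hmul x 1 t y
      rw [if_neg (Ne.symm hy), ht, if_pos rfl, one_mul] at this
      exact this

/-- A bialgebra map of doubles restricts to group-like elements. -/
theorem exists_map_charElem_one (ψ : DrinfeldDouble k G →ₐc[k] DrinfeldDouble k G) :
    ∃ (β : G →* G) (χ : G → G →* k), ∀ h, ψ (charElem 1 h) = charElem (χ h) (β h) := by
  choose χ β hβ using fun h : G =>
    IsGroupLikeElem.exists_eq_charElem ((isGroupLikeElem_charElem_one (k := k) h).map ψ)
  refine ⟨MonoidHom.mk' β fun a b => ?_, χ, hβ⟩
  have h1 : charElem (χ (a * b)) (β (a * b)) = charElem (χ a * χ b) (β a * β b) := by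
    rw [← charElem_mul_charElem, ← hβ, ← hβ, ← hβ, ← map_mul, charElem_mul_charElem, one_mul]
  by_contra hne
  -- Characters take the value `1` at the identity, so this coefficient sees only the group parts.
  have h2 := congrArg (fun z => z.coeff 1 (β (a * b))) h1
  simp [coeff_charElem, hne] at h2

/-! ### The inclusions and projections -/

theorem inclDual_e (g : G) : inclDual (GroupDualCop.e g : GroupDualCop k G) = E g 1 := by
  rw [← hashTmul_e_single]
  rfl

theorem inclGroup_of (h : G) : inclGroup (MonoidAlgebra.of k G h) = charElem (1 : G →* k) h := by
  ext x y
  simp [inclGroup, hashTmul, coeff_charElem, Finsupp.single_apply, eq_comm (a := h)]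

theorem coeff_inclDual (a : GroupDualCop k G) (x y : G) :
    (inclDual a).coeff x y = if y = 1 then a.eval x else 0 := by
  simp [inclDual, hashTmul, MonoidAlgebra.one_def, Finsupp.single_apply, eq_comm (a := y)]

theorem inclDual_mul (a b : GroupDualCop k G) : inclDual (a * b) = inclDual a * inclDual b := by
  ext x y
  rw [coeff_mul, Finset.sum_eq_single 1]
  · simp [coeff_inclDual]
  · intro s _ hs
    simp [coeff_inclDual, hs]
  · simp

theorem inclDual_one : inclDual (1 : GroupDualCop k G) = 1 := by
  ext x y
  simp [coeff_inclDual, coeff_one]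

theorem charElem_eq_mul (χ : G →* k) (h : G) :
    charElem χ h = inclDual (GroupDualCop.of χ) * charElem 1 h := by
  ext x y
  simp [coeff_mul_charElem, coeff_inclDual, coeff_charElem, mul_inv_eq_one]

/-- Linear characters are class functions, so the conjugation in the product of `D(G)` does not move
them. -/
theorem charElem_one_mul_inclDual (χ : G →* k) (h : G) :
    charElem 1 h * inclDual (GroupDualCop.of χ) =
      (inclDual (GroupDualCop.of χ) * charElem 1 h : DrinfeldDouble k G) := by
  ext x y
  simp only [coeff_mul_charElem, coeff_charElem_mul, coeff_inclDual, GroupDualCop.eval_of,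
    map_conj_eq, mul_inv_eq_one, inv_mul_eq_one, eq_comm (a := h)]
  simp

theorem coeff_projGroup (x : DrinfeldDouble k G) (h : G) :
    (projGroup x).coeff h = x.coeff 1 h := by
  simp [projGroup, Finsupp.single_apply]

theorem eval_projDual (x : DrinfeldDouble k G) (g : G) :
    (projDual x).eval g = ∑ h, x.coeff g h := rfl

theorem projGroup_charElem (χ : G →* k) (h : G) :
    projGroup (charElem χ h) = MonoidAlgebra.of k G h := by
  ext y
  simp [coeff_projGroup, coeff_charElem, Finsupp.single_apply, eq_comm (a := h)]

/-- The identity is alone in its conjugacy class, so evaluation there ignores the twist in the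
product. For `projDual` the twist in general survives, which is why multiplicativity of `u` needs a
separate argument. -/
theorem projGroup_mul (x y : DrinfeldDouble k G) :
    projGroup (x * y) = projGroup x * projGroup y := by
  suffices h : (LinearMap.mul k (DrinfeldDouble k G)).compr₂ projGroup =
      (LinearMap.mul k (MonoidAlgebra k G)).compl₁₂ projGroup projGroup from
    LinearMap.congr_fun₂ h x y
  refine hom_ext fun g g' => hom_ext fun h h' => ?_
  simp only [LinearMap.compr₂_apply, LinearMap.compl₁₂_apply, LinearMap.mul_apply', E_mul_E,
    projGroup_E]
  by_cases hg : g = 1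
  · subst hg
    by_cases hh : h = 1
    · subst hh
      simp [projGroup_E]
    · have : ¬ (1 = g' * h * g'⁻¹) := fun h1 => hh (conj_eq_one_iff.mp h1.symm)
      simp [this, hh]
  · by_cases hc : g = g' * h * g'⁻¹
    · rw [if_pos hc]
      simp [hg, projGroup_E]
    · simp [hc, hg]

end DrinfeldDouble
end
noncomputable section

namespace DrinfeldDouble

variable {k G : Type*} [Field k] [Group G] [Fintype G] [DecidableEq G]

open GroupDualCop (e)

/-! ### The components in coordinates -/

section Components

variable (ψ : DrinfeldDouble k G →ₐc[k] DrinfeldDouble k G)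

theorem compU_apply (a : GroupDualCop k G) : compU ψ a = projDual (ψ (inclDual a)) := rfl

theorem compP_apply (a : GroupDualCop k G) : compP ψ a = projGroup (ψ (inclDual a)) := rfl

theorem compV_apply (x : MonoidAlgebra k G) : compV ψ x = projGroup (ψ (inclGroup x)) := rfl

theorem compU_e_eval (g x : G) : (compU ψ (e g)).eval x = ∑ y, (ψ (E g 1)).coeff x y := by
  rw [compU_apply, inclDual_e, eval_projDual]

theorem compP_e_coeff (g y : G) : (compP ψ (e g)).coeff y = (ψ (E g 1)).coeff 1 y := by
  rw [compP_apply, inclDual_e, coeff_projGroup]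

/-- Together with `sum_compP_mul_compU`: `u` and `p` determine `ψ` on `k^G` by convolution in either
order, since `x * 1 = 1 * x` in the first index. The agreement of the two orders drives the
centrality results. -/
theorem sum_compU_mul_compP (g x y : G) :
    ∑ s : G, (compU ψ (e (s⁻¹ * g))).eval x * (compP ψ (e s)).coeff y =
      (ψ (E g 1)).coeff x y := by
  simp only [compU_e_eval, compP_e_coeff, Finset.sum_mul]
  rw [Finset.sum_comm]
  simp [sum_coeff_mul_coeff]

theorem sum_compP_mul_compU (g x y : G) :
    ∑ s : G, (compP ψ (e (s⁻¹ * g))).coeff y * (compU ψ (e s)).eval x =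
      (ψ (E g 1)).coeff x y := by
  simp only [compU_e_eval, compP_e_coeff, Finset.mul_sum]
  rw [Finset.sum_comm]
  simp [sum_coeff_mul_coeff]

theorem sum_compU_mul_compU (g x y : G) :
    ∑ s : G, (compU ψ (e (s⁻¹ * g))).eval y * (compU ψ (e s)).eval x =
      (compU ψ (e g)).eval (x * y) := by
  simp only [compU_e_eval, Finset.sum_mul_sum]
  rw [Finset.sum_comm]
  refine Finset.sum_congr rfl fun h _ => ?_
  rw [Finset.sum_comm]
  simp [sum_coeff_mul_coeff]

theorem sum_compP_mul_compP (g y y' : G) :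
    ∑ s : G, (compP ψ (e (s⁻¹ * g))).coeff y * (compP ψ (e s)).coeff y' =
      if y = y' then (compP ψ (e g)).coeff y else 0 := by
  simp only [compP_e_coeff, sum_coeff_mul_coeff, mul_one]

theorem compP_mul (a b : GroupDualCop k G) : compP ψ (a * b) = compP ψ a * compP ψ b := by
  rw [compP_apply, inclDual_mul, map_mul, projGroup_mul]
  rfl

theorem compP_commute (a b : GroupDualCop k G) : Commute (compP ψ a) (compP ψ b) := by
  rw [Commute, SemiconjBy, ← compP_mul, mul_comm, compP_mul]

theorem compU_one : compU ψ 1 = 1 := by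
  rw [compU_apply, inclDual_one, map_one]
  ext x
  simp [eval_projDual, coeff_one]

theorem compP_coeff (a : GroupDualCop k G) (y : G) :
    (compP ψ a).coeff y = ∑ s, a.eval s * (compP ψ (e s)).coeff y := by
  conv_lhs => rw [← GroupDualCop.sum_eval_smul_e a]
  simp

/-- The component `u` is invariant under conjugation by the elements which the component `p`
does not annihilate. -/
theorem compU_e_conj {b : G} (hb : compP ψ (e b) ≠ 0) (g : G) :
    compU ψ (e (b * g * b⁻¹)) = compU ψ (e g) := by
  ext x
  -- The two convolution formulas at index `b * g` say that `p` kills `F`. As `p` is multiplicative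
  -- its kernel is an ideal, so `F(b) p(e_b) = 0`, and `F(b)` is the difference of the two sides.
  let F : GroupDualCop k G := GroupDualCop.of fun s =>
    (compU ψ (e (s⁻¹ * (b * g)))).eval x - (compU ψ (e (b * g * s⁻¹))).eval x
  have hF : compP ψ F = 0 := by
    ext y
    rw [compP_coeff]
    simp only [F, GroupDualCop.eval_of, sub_mul, Finset.sum_sub_distrib, sum_compU_mul_compP]
    rw [← sum_compP_mul_compU, MonoidAlgebra.coeff_zero, Finsupp.zero_apply, sub_eq_zero]
    refine Fintype.sum_equiv ((Equiv.inv G).trans (Equiv.mulRight (b * g))) _ _ fun s => ?_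
    simp [mul_comm (GroupDualCop.eval _ _), mul_assoc]
  have hFb : F * e b = F.eval b • e b := by
    ext s
    by_cases hs : s = b <;> simp [hs]
  have h1 : F.eval b • compP ψ (e b) = 0 := by
    rw [← map_smul, ← hFb, compP_mul, hF, zero_mul]
  have h2 := (smul_eq_zero.mp h1).resolve_right hb
  simp only [F, GroupDualCop.eval_of, inv_mul_cancel_left] at h2
  exact (sub_eq_zero.mp h2).symm

/-! ### Equivariance of `u` and `p` under conjugation. -/

variable {ψ} {β : G →* G} {χ : G → G →* k}
  (hβ : ∀ h, ψ (charElem 1 h) = charElem (χ h) (β h))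

include hβ

theorem compV_of (g : G) : compV ψ (MonoidAlgebra.of k G g) = MonoidAlgebra.of k G (β g) := by
  rw [compV_apply, inclGroup_of, hβ, projGroup_charElem]

theorem coeff_map_E_conj (g h x y : G) : (ψ (E (h * g * h⁻¹) 1)).coeff x y =
    (ψ (E g 1)).coeff ((β h)⁻¹ * x * β h) ((β h)⁻¹ * y * β h) := by
  have h1 := congrArg (fun z => (ψ z).coeff x (y * β h)) (charElem_one_mul_E (k := k) g h)
  simp only [map_mul, hβ, coeff_charElem_mul, coeff_mul_charElem, mul_inv_cancel_right] at h1
  have h2 : χ h x ≠ 0 := ((Group.isUnit x).map (χ h)).ne_zero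
  rw [mul_comm] at h1
  rw [← mul_assoc] at h1
  exact (mul_right_cancel₀ h2 h1).symm

theorem compU_e_conj_eval (g h x : G) :
    (compU ψ (e (h * g * h⁻¹))).eval x = (compU ψ (e g)).eval ((β h)⁻¹ * x * β h) := by
  simp only [compU_e_eval, coeff_map_E_conj hβ]
  exact Fintype.sum_equiv ((Equiv.mulLeft (β h)⁻¹).trans (Equiv.mulRight (β h))) _ _ fun y => rfl

theorem eval_projDual_map_E (g h x : G) :
    (projDual (ψ (E g h))).eval x = (compU ψ (e g)).eval x * χ h x := by
  rw [← E_mul_charElem_one, map_mul, hβ, eval_projDual, compU_e_eval, Finset.sum_mul]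
  simp only [coeff_mul_charElem]
  exact Fintype.sum_equiv (Equiv.mulRight (β h)⁻¹) _ _ fun y => rfl

/-- Invariance of `u` under conjugation by `b` becomes, by equivariance, invariance of every
function `projDual (ψ z)` under conjugation by `β b`. Surjectivity makes every `e x` such a
function, so `β b` fixes each `x`. -/
theorem map_mem_center_of_compP_ne_zero (hψ : Function.Surjective ψ) {b : G}
    (hb : compP ψ (e b) ≠ 0) : β b ∈ Subgroup.center G := by
  have hinv : ∀ z x, (projDual (ψ z)).eval ((β b)⁻¹ * x * β b) = (projDual (ψ z)).eval x := by
    intro z x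
    rw [← sum_coeff_smul_E z]
    simp only [map_sum, map_smul, GroupDualCop.eval_sum, GroupDualCop.eval_smul,
      eval_projDual_map_E hβ, map_conj_eq, ← compU_e_conj_eval hβ, compU_e_conj ψ hb]
  refine Subgroup.mem_center_iff.mpr fun x => ?_
  obtain ⟨z, hz⟩ := hψ (E x 1)
  have h1 := hinv z x
  rw [hz, projDual_E, GroupDualCop.eval_e, GroupDualCop.eval_e, if_pos rfl] at h1
  have h2 : (β b)⁻¹ * x * β b = x := by
    by_contra hne
    simp [hne] at h1
  rw [mul_assoc, inv_mul_eq_iff_eq_mul] at h2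
  exact h2

theorem of_map_mul_compP_e (g h : G) : MonoidAlgebra.of k G (β h) * compP ψ (e g) =
    compP ψ (e (h * g * h⁻¹)) * MonoidAlgebra.of k G (β h) := by
  have h1 := congrArg (fun z => projGroup (ψ z)) (charElem_one_mul_E (k := k) g h)
  simpa only [map_mul, hβ, projGroup_mul, projGroup_charElem, compP_apply, inclDual_e] using h1

theorem of_map_commute_compP_character (χ' : G →* k) (h : G) :
    Commute (MonoidAlgebra.of k G (β h)) (compP ψ (GroupDualCop.of χ')) := by
  have h1 := congrArg (fun z => projGroup (ψ z)) (charElem_one_mul_inclDual χ' h)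
  simp only [map_mul, hβ, projGroup_mul, projGroup_charElem, ← compP_apply] at h1
  exact h1

end Components

/-! ### Automorphisms -/

section Automorphism

variable {ψ ψ' : DrinfeldDouble k G →ₐc[k] DrinfeldDouble k G}
  {β β' : G →* G} {χ χ' : G → G →* k}
  (hβ : ∀ h, ψ (charElem 1 h) = charElem (χ h) (β h))
  (hβ' : ∀ h, ψ' (charElem 1 h) = charElem (χ' h) (β' h))
  (hl : ∀ z, ψ' (ψ z) = z) (hr : ∀ z, ψ (ψ' z) = z)

include hβ hβ' hl

/-- Factor `ψ(ε # g)` as `(χ_g # 1)(ε # β g)`, apply `ψ'` and project to `kG`. -/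
theorem compP_character_mul_of (g : G) :
    compP ψ' (GroupDualCop.of (χ g)) * MonoidAlgebra.of k G (β' (β g)) =
      MonoidAlgebra.of k G g := by
  rw [compP_apply, ← projGroup_charElem (χ' (β g)), ← hβ', ← projGroup_mul, ← map_mul,
    ← charElem_eq_mul, ← hβ, hl, projGroup_charElem]

theorem compP_character (g : G) : compP ψ' (GroupDualCop.of (χ g)) =
    MonoidAlgebra.of k G (g * (β' (β g))⁻¹) := by
  rw [map_mul, ← compP_character_mul_of hβ hβ' hl g, mul_assoc, ← map_mul, mul_inv_cancel,
    map_one, mul_one]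

include hr

/-- Write each `g` as `c g * β' (β g)` with `c g = p'(χ_g)`. The `c g` commute with one another
because `k^G` is commutative, and with the image of `β'` because characters are class functions.
Since `β b` is central, `β' (β b)` commutes with every `β' (β h)`, so both factors of `b` commute
with both factors of `h`. -/
theorem mem_center_of_compP_ne_zero {b : G} (hb : compP ψ (e b) ≠ 0) :
    b ∈ Subgroup.center G := by
  have hinj := MonoidAlgebra.of_injective (R := k) (M := G)
  have hv := Subgroup.mem_center_iff.mp
    (map_mem_center_of_compP_ne_zero hβ (fun z => ⟨ψ' z, hr z⟩) hb)
  set c : G → G := fun g => g * (β' (β g))⁻¹ with hc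
  have hcP : ∀ g, compP ψ' (GroupDualCop.of (χ g)) = MonoidAlgebra.of k G (c g) :=
    compP_character hβ hβ' hl
  have hcc : ∀ g h, Commute (c g) (c h) := fun g h => by
    have h1 := compP_commute ψ' (GroupDualCop.of (χ g)) (GroupDualCop.of (χ h))
    rw [hcP, hcP, Commute, SemiconjBy, ← map_mul, ← map_mul] at h1
    exact hinj h1
  have hcβ : ∀ g t, Commute (β' t) (c g) := fun g t => by
    have h1 := of_map_commute_compP_character hβ' (χ g) t
    rw [hcP, Commute, SemiconjBy, ← map_mul, ← map_mul] at h1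
    exact hinj h1
  have hββ : ∀ h, Commute (β' (β b)) (β' (β h)) := fun h => by
    rw [Commute, SemiconjBy, ← map_mul, ← hv, map_mul]
  have hdec : ∀ g, g = c g * β' (β g) := fun g => by simp [hc]
  refine Subgroup.mem_center_iff.mpr fun h => ?_
  have h1 : Commute (c h * β' (β h)) (c b * β' (β b)) :=
    ((hcc h b).mul_right (hcβ h _).symm).mul_left ((hcβ b _).mul_right (hββ h).symm)
  rw [← hdec, ← hdec] at h1
  exact h1

/-- Every `h` is a product of an element of the image of `p`, which is commutative, and an element
of the image of `β`. The latter commutes with `p(e_g)` because conjugating `g` does not change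
`p(e_g)`. -/
theorem compP_e_commute_of (g h : G) : Commute (compP ψ (e g)) (MonoidAlgebra.of k G h) := by
  have hβc : ∀ t, Commute (compP ψ (e g)) (MonoidAlgebra.of k G (β t)) := by
    intro t
    have hconj : compP ψ (e (t * g * t⁻¹)) = compP ψ (e g) := by
      by_cases h1 : compP ψ (e g) = 0
      · have h3 := of_map_mul_compP_e hβ g t
        rw [h1, mul_zero] at h3
        have h4 := congrArg (· * MonoidAlgebra.of k G (β t)⁻¹) h3
        simp only [zero_mul, mul_assoc, ← map_mul, mul_inv_cancel, map_one, mul_one] at h4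
        rw [h1, mul_assoc, ← h4]
      · have h2 := Subgroup.mem_center_iff.mp (mem_center_of_compP_ne_zero hβ hβ' hl hr h1) t
        rw [h2, mul_inv_cancel_right]
    have h3 := of_map_mul_compP_e hβ g t
    rw [hconj] at h3
    exact h3.symm
  rw [← compP_character_mul_of hβ' hβ hr h]
  exact (compP_commute ψ _ _).mul_right (hβc _)

theorem compP_commute_of (a : GroupDualCop k G) (h : G) :
    Commute (compP ψ a) (MonoidAlgebra.of k G h) := by
  rw [← GroupDualCop.sum_eval_smul_e a, map_sum]
  refine Commute.sum_left _ _ _ fun g _ => ?_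
  rw [map_smul]
  exact (compP_e_commute_of hβ hβ' hl hr g h).smul_left _

/-- The image of `p` is stable under extracting the `y`-component, by `sum_compP_mul_compP`. Hence
it contains a nonzero multiple of `y`, and that image is central. -/
theorem mem_center_of_coeff_compP_ne_zero {g y : G} (hy : (compP ψ (e g)).coeff y ≠ 0) :
    y ∈ Subgroup.center G := by
  have h1 : compP ψ (GroupDualCop.of fun s => (compP ψ (e (s⁻¹ * g))).coeff y) =
      (compP ψ (e g)).coeff y • MonoidAlgebra.of k G y := by
    ext y'
    rw [compP_coeff]
    simp [sum_compP_mul_compP, Finsupp.single_apply]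
  refine Subgroup.mem_center_iff.mpr fun h => ?_
  have h2 := compP_commute_of hβ hβ' hl hr
    (GroupDualCop.of fun s => (compP ψ (e (s⁻¹ * g))).coeff y) h
  rw [h1, Commute, SemiconjBy, smul_mul_assoc, mul_smul_comm, ← map_mul, ← map_mul] at h2
  exact (MonoidAlgebra.of_injective (smul_right_injective _ hy h2)).symm

/-- In a product in `D(G)` the second factor is conjugated by the group part `s` of the first. Here
only central `s` have nonzero coefficient, so the twist disappears. -/
theorem compU_e_mul_e (g g' : G) : compU ψ (e g * e g') = compU ψ (e g) * compU ψ (e g') := by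
  ext x
  have hs : ∀ s y, (ψ (E g 1)).coeff x s * (ψ (E g' 1)).coeff (s⁻¹ * x * s) y =
      (ψ (E g 1)).coeff x s * (ψ (E g' 1)).coeff x y := by
    intro s y
    by_cases h1 : (ψ (E g 1)).coeff x s = 0
    · rw [h1, zero_mul, zero_mul]
    · rw [← sum_compU_mul_compP] at h1
      obtain ⟨a, -, ha⟩ := Finset.exists_ne_zero_of_sum_ne_zero h1
      have h2 := Subgroup.mem_center_iff.mp
        (mem_center_of_coeff_compP_ne_zero hβ hβ' hl hr (right_ne_zero_of_mul ha)) x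
      rw [mul_assoc, h2, inv_mul_cancel_left]
  rw [compU_apply, inclDual_mul, map_mul, inclDual_e, inclDual_e, eval_projDual,
    GroupDualCop.eval_mul, compU_e_eval, compU_e_eval, Finset.sum_mul_sum]
  simp only [coeff_mul, hs]
  rw [Finset.sum_comm]
  refine Finset.sum_congr rfl fun s _ => ?_
  exact Fintype.sum_equiv (Equiv.mulLeft s⁻¹) _ _ fun y => rfl

/-- The component `u` of an automorphism is dual to a group endomorphism. -/
theorem exists_compU_e_eval : ∃ α : G →* G, ∀ g x,
    (compU ψ (e g)).eval x = if g = α x then 1 else 0 := by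
  have h1 : ∀ x, ∃ t, ∀ g, (compU ψ (e g)).eval x = if g = t then 1 else 0 := by
    intro x
    refine exists_eq_ite_of_orthogonal _ (fun g g' => ?_) ?_
    · rw [← GroupDualCop.eval_mul, ← compU_e_mul_e hβ hβ' hl hr, GroupDualCop.e_mul_e]
      split_ifs <;> simp
    · rw [← GroupDualCop.eval_sum, ← map_sum, GroupDualCop.sum_e, compU_one,
        GroupDualCop.eval_one]
  choose α hα using h1
  refine ⟨MonoidHom.mk' α fun x y => ?_, fun g x => hα x g⟩
  -- At this index the convolution sum has the single nonzero term `s = α x`, so the right side must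
  -- be `1`.
  have h2 := sum_compU_mul_compU ψ (α x * α y) x y
  simp only [hα] at h2
  rw [Finset.sum_eq_single (α x) (fun s _ hs => by simp [hs]) (by simp)] at h2
  by_contra hne
  simp [Ne.symm hne] at h2

theorem map_map_mem_center (g : G) : g * (β' (β g))⁻¹ ∈ Subgroup.center G := by
  refine Subgroup.mem_center_iff.mpr fun h => ?_
  have h1 := compP_commute_of hβ' hβ hr hl (GroupDualCop.of (χ g)) h
  rw [compP_character hβ hβ' hl, Commute, SemiconjBy, ← map_mul, ← map_mul] at h1
  exact (MonoidAlgebra.of_injective h1).symm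

/-- Evaluating `ψ (ψ' (e_x # 1))` at `x` gives `1`, whereas the expansion involves only coefficients
of `p'(e_b)` with `b = x (α' (α x))⁻¹`. Hence `p'(e_b) ≠ 0`, and `b` is central. -/
theorem dual_map_map_mem_center {α α' : G →* G}
    (hα : ∀ g x, (compU ψ (e g)).eval x = if g = α x then 1 else 0)
    (hα' : ∀ g x, (compU ψ' (e g)).eval x = if g = α' x then 1 else 0) (x : G) :
    x * (α' (α x))⁻¹ ∈ Subgroup.center G := by
  have h1 : (projDual (ψ (ψ' (E x 1)))).eval x = 1 := by rw [hr, projDual_E]; simp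
  rw [← sum_coeff_smul_E (ψ' (E x 1))] at h1
  simp only [map_sum, map_smul, GroupDualCop.eval_sum, GroupDualCop.eval_smul,
    eval_projDual_map_E hβ, hα] at h1
  have h2 : ∀ y, (ψ' (E x 1)).coeff (α x) y =
      (compP ψ' (e (x * (α' (α x))⁻¹))).coeff y := by
    intro y
    rw [← sum_compU_mul_compP, Finset.sum_eq_single (x * (α' (α x))⁻¹)]
    · simp [hα']
    · intro s _ hs
      have : ¬ (s⁻¹ * x = α' (α x)) := fun h => hs (by rw [← h]; group)
      simp [hα', this]
    · simp
  refine mem_center_of_compP_ne_zero hβ' hβ hr hl fun h0 => ?_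
  rw [Finset.sum_eq_single (α x) (fun s _ hs => by simp [hs]) (by simp)] at h1
  simp [h2, h0] at h1

end Automorphism

end DrinfeldDouble

/-! ### The bialgebra isomorphism dual to a group isomorphism -/

namespace GroupDualCop

variable {k G : Type*} [Field k] [Group G] [Fintype G] [DecidableEq G]

/-- Precomposition with a group automorphism as an isomorphism of bialgebras. -/
def precompBialgEquiv (α : G ≃* G) : GroupDualCop k G ≃ₐc[k] GroupDualCop k G :=
  BialgEquiv.ofAlgEquiv
    (AlgEquiv.ofLinearEquiv
      { toFun := fun a => of fun x => a.eval (α x)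
        invFun := fun a => of fun x => a.eval (α.symm x)
        map_add' := fun _ _ => rfl
        map_smul' := fun _ _ => rfl
        left_inv := fun a => by ext; simp
        right_inv := fun a => by ext; simp }
      rfl (fun _ _ => rfl))
    (AlgHom.toLinearMap_injective (LinearMap.ext fun a => by
      change a.eval (α 1) = a.eval 1
      rw [map_one]))
    (AlgHom.toLinearMap_injective (hom_ext fun g => by
      have he : ∀ t : G, (of fun x => (e t : GroupDualCop k G).eval (α x)) =
          (e (α.symm t) : GroupDualCop k G) := fun t => by
        ext x
        simp [MulEquiv.eq_symm_apply]
      change TensorProduct.map _ _ (Coalgebra.comul (R := k) (e g : GroupDualCop k G)) =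
        Coalgebra.comul (R := k) (of fun x => (e g : GroupDualCop k G).eval (α x))
      rw [he, comul_e, comul_e, map_sum]
      refine Fintype.sum_equiv α.symm.toEquiv _ _ fun s => ?_
      rw [TensorProduct.map_tmul]
      change (of fun x => (e (s⁻¹ * g) : GroupDualCop k G).eval (α x)) ⊗ₜ[k]
        (of fun x => (e s : GroupDualCop k G).eval (α x)) = _
      rw [he, he]
      simp))

theorem precompBialgEquiv_apply (α : G ≃* G) (a : GroupDualCop k G) (x : G) :
    (precompBialgEquiv α a).eval x = a.eval (α x) := rfl

end GroupDualCop
end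

/-! ### Assembly and the purely non-abelian case. -/

theorem PurelyNonabelian.injective {G : Type*} [Group G] (hG : PurelyNonabelian G) {f : G →* G}
    (hf : ∃ K : Subgroup G, IsAbelianDirectFactor K ∧ f.ker ≤ K) : Function.Injective f := by
  obtain ⟨K, hK, hle⟩ := hf
  rw [← MonoidHom.ker_eq_bot_iff, eq_bot_iff, ← hG K hK]
  exact hle

namespace DrinfeldDouble

variable {k G : Type*} [Field k] [Group G] [Fintype G] [DecidableEq G]

/-- The components `u` and `v` of an automorphism are given by group endomorphisms whose kernels
are contained in abelian direct factors. -/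
theorem exists_endomorphisms (ψ : DrinfeldDouble k G ≃ₐc[k] DrinfeldDouble k G) :
    ∃ α β : G →* G,
      (∀ g x, (compU ψ.toBialgHom (GroupDualCop.e g)).eval x = if g = α x then 1 else 0) ∧
      (∀ g, compV ψ.toBialgHom (MonoidAlgebra.of k G g) = MonoidAlgebra.of k G (β g)) ∧
      (∃ K : Subgroup G, IsAbelianDirectFactor K ∧ α.ker ≤ K) ∧
      (∃ K : Subgroup G, IsAbelianDirectFactor K ∧ β.ker ≤ K) := by
  have hl : ∀ z, ψ.symm.toBialgHom (ψ.toBialgHom z) = z := ψ.symm_apply_apply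
  have hr : ∀ z, ψ.toBialgHom (ψ.symm.toBialgHom z) = z := ψ.apply_symm_apply
  obtain ⟨β, χ, hβ⟩ := exists_map_charElem_one ψ.toBialgHom
  obtain ⟨β', χ', hβ'⟩ := exists_map_charElem_one ψ.symm.toBialgHom
  obtain ⟨α, hα⟩ := exists_compU_e_eval hβ hβ' hl hr
  obtain ⟨α', hα'⟩ := exists_compU_e_eval hβ' hβ hr hl
  exact ⟨α, β, hα, compV_of hβ,
    exists_isAbelianDirectFactor_ker_le α α' (dual_map_map_mem_center hβ hβ' hl hr hα hα'),
    exists_isAbelianDirectFactor_ker_le β β' (map_map_mem_center hβ hβ' hl hr)⟩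

end DrinfeldDouble

/-- Let `ψ = (p, u, r, v)` be an automorphism of the Hopf algebra `D(G)`. Then `u^*` and `v` are
given on `G` by group endomorphisms `α` and `β`, the kernel of each of which is contained in an
abelian direct factor of `G`. If `G` is purely non-abelian, then `u` and `v` are isomorphisms of
Hopf algebras for every such `ψ`. -/
theorem mainTheorem5 (k : Type*) [Field k] [IsAlgClosed k] [CharZero k]
    (G : Type*) [Group G] [Fintype G] [DecidableEq G] :
    (∀ ψ : DrinfeldDouble k G ≃ₐc[k] DrinfeldDouble k G,
      ∃ α β : G →* G,
        (∀ g : G, GroupDualCop.dualMap (DrinfeldDouble.compU ψ.toBialgHom)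
          (MonoidAlgebra.of k G g) = MonoidAlgebra.of k G (α g)) ∧
        (∀ g : G, DrinfeldDouble.compV ψ.toBialgHom
          (MonoidAlgebra.of k G g) = MonoidAlgebra.of k G (β g)) ∧
        (∃ K : Subgroup G, IsAbelianDirectFactor K ∧ α.ker ≤ K) ∧
        (∃ K : Subgroup G, IsAbelianDirectFactor K ∧ β.ker ≤ K)) ∧
    (PurelyNonabelian G →
      ∀ ψ : DrinfeldDouble k G ≃ₐc[k] DrinfeldDouble k G,
        (∃ U : GroupDualCop k G ≃ₐc[k] GroupDualCop k G,
          ∀ a, DrinfeldDouble.compU ψ.toBialgHom a = U a) ∧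
        (∃ V : MonoidAlgebra k G ≃ₐc[k] MonoidAlgebra k G,
          ∀ x, DrinfeldDouble.compV ψ.toBialgHom x = V x)) := by
  refine ⟨fun ψ => ?_, fun hG ψ => ?_⟩
  · obtain ⟨α, β, hα, hβ, hKα, hKβ⟩ := DrinfeldDouble.exists_endomorphisms ψ
    refine ⟨α, β, fun g => ?_, hβ, hKα, hKβ⟩
    ext y
    simp [GroupDualCop.dualMap, GroupDualCop.pairing, hα, Finsupp.single_apply,
      -BialgEquiv.toBialgHom_eq_coe]
    rw [Finset.sum_eq_single g (fun x _ hx => by simp [hx.symm]) (by simp)]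
    simp [eq_comm]
  · obtain ⟨α, β, hα, hβ, hKα, hKβ⟩ := DrinfeldDouble.exists_endomorphisms ψ
    let α' : G ≃* G := MulEquiv.ofBijective α (Finite.injective_iff_bijective.mp (hG.injective hKα))
    let β' : G ≃* G := MulEquiv.ofBijective β (Finite.injective_iff_bijective.mp (hG.injective hKβ))
    refine ⟨⟨GroupDualCop.precompBialgEquiv α', fun a => ?_⟩,
      ⟨MonoidAlgebra.domCongrBialgEquiv k k β', fun x => ?_⟩⟩
    · ext x
      rw [GroupDualCop.precompBialgEquiv_apply]
      conv_lhs => rw [← GroupDualCop.sum_eval_smul_e a]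
      simp [hα, α', -BialgEquiv.toBialgHom_eq_coe]
    · induction x using MonoidAlgebra.induction_linear with
      | zero => simp
      | add x y hx hy => rw [map_add, map_add, hx, hy]
      | single g c =>
        have h1 : MonoidAlgebra.single g c = c • MonoidAlgebra.of k G g := by simp
        rw [h1, map_smul, map_smul, hβ]
        exact congrArg (c • ·) (MonoidAlgebra.domCongr_single (R := k) β' g (1 : k)).symm
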